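/- Let $m,n,p\ge 1$ be integers, and let $K_{m,n,p}$ be the complete tripartite graph on labeled vertices, whose vertex set is the union of three pairwise disjoint sets $H_m,H_n,H_p$ with $m$, $n$ and $p$ elements respectively, two vertices being adjacent if and only if they lie in different ones of these sets. Then the number $|T_{m,n,p}|$ of labeled spanning trees of $K_{m,n,p}$ is $$|T_{m,n,p}|=(m+n)^{p-1}(m+p)^{n-1}(n+p)^{m-1}(m+n+p).$$ -/

import Mathlib

/-- The complete tripartite graph `K_{m,n,p}`: its vertex set is the disjoint union of three sets
(indexed by `0, 1, 2 : Fin 3`) with `m`, `n` and `p` elements, and two vertices are adjacent if and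
only if they lie in different parts. -/
abbrev completeTripartiteGraph (m n p : ℕ) :
    SimpleGraph (Σ i : Fin 3, Fin (![m, n, p] i)) :=
  SimpleGraph.completeMultipartiteGraph fun i : Fin 3 => Fin (![m, n, p] i)

/-- The set of spanning trees of `G`: trees on the whole vertex set of `G` all of whose edges are
edges of `G`. Vertices are labeled: isomorphic but different trees are different elements. -/
def labeledSpanningTrees {V : Type*} (G : SimpleGraph V) : Set (SimpleGraph V) :=
  {T | T ≤ G ∧ T.IsTree}

/-! Rooting at `r` turns spanning trees into parent functions (`bijOn_functionGraph`). Each row of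
the reduced Laplacian is a sum over admissible parents, so multilinearity expands its determinant
over all choices of parents; a choice contributes 1 if its iterates all reach `r` and 0 otherwise.
This is the matrix-tree theorem `det_rootedLaplacian`. For a complete multipartite graph, adjacency
depends only on the parts, so the Laplacian is a diagonal matrix times `1 - A * B` with `A`, `B`
factoring through the set of parts. Since `det (1 - A * B) = det (1 - B * A)`, three parts leave a 3
× 3 determinant. -/

/-- The admissible parents of a vertex `v` in a spanning tree of `G` rooted at `r`: the neighbors
of `v`, except that the root is its own parent. -/
noncomputable def parentChoices {V : Type*} [Fintype V] (G : SimpleGraph V) (r v : V) : Finset V :=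
  open Classical in if v = r then {r} else G.neighborFinset v

/-! ### Spanning trees as parent functions -/

section Functional

variable {V : Type*} {r : V} {f g : V → V}

/-- The iterates of `f` lead every vertex to the fixed point `r`. -/
def IsParentMap (r : V) (f : V → V) : Prop :=
  f r = r ∧ ∀ v, ∃ k, f^[k] v = r

/-- The graph joining each vertex to its image under `f`. -/
def functionGraph (f : V → V) : SimpleGraph V :=
  SimpleGraph.fromRel fun v u => f v = u

lemma functionGraph_adj {v u : V} :
    (functionGraph f).Adj v u ↔ v ≠ u ∧ (f v = u ∨ f u = v) :=
  SimpleGraph.fromRel_adj _ _ _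

lemma functionGraph_reachable_apply (f : V → V) (v : V) :
    (functionGraph f).Reachable v (f v) := by
  by_cases h : v = f v
  · rw [← h]
  · exact (functionGraph_adj.2 ⟨h, Or.inl rfl⟩).reachable

lemma functionGraph_reachable_iterate (f : V → V) (k : ℕ) (v : V) :
    (functionGraph f).Reachable v (f^[k] v) := by
  induction k generalizing v with
  | zero => exact .refl _
  | succ k ih => exact (functionGraph_reachable_apply f v).trans (ih (f v))

lemma IsParentMap.functionGraph_connected (hf : IsParentMap r f) :
    (functionGraph f).Connected := by
  have h : ∀ v, (functionGraph f).Reachable v r := fun v => by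
    obtain ⟨k, hk⟩ := hf.2 v
    exact hk ▸ functionGraph_reachable_iterate f k v
  exact (SimpleGraph.connected_iff _).2 ⟨fun v u => (h v).trans (h u).symm, ⟨r⟩⟩

lemma IsParentMap.functionGraph_isTree [Finite V] (hf : IsParentMap r f) :
    (functionGraph f).IsTree := by
  classical
  have := Fintype.ofFinite V
  rw [SimpleGraph.isTree_iff_connected_and_card]
  refine ⟨hf.functionGraph_connected,
    le_antisymm ?_ hf.functionGraph_connected.card_vert_le_card_edgeSet_add_one⟩
  have hsub : (functionGraph f).edgeSet ⊆
      ((Finset.univ.erase r).image fun v => s(v, f v) : Finset (Sym2 V)) := by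
    intro e
    induction e using Sym2.ind with
    | _ v u =>
      rw [SimpleGraph.mem_edgeSet, functionGraph_adj]
      rintro ⟨hne, h | h⟩
      · simp only [Finset.coe_image, Set.mem_image, Finset.mem_coe, Finset.mem_erase]
        refine ⟨v, ⟨?_, Finset.mem_univ _⟩, by rw [h]⟩
        rintro rfl
        exact hne (hf.1.symm.trans h)
      · simp only [Finset.coe_image, Set.mem_image, Finset.mem_coe, Finset.mem_erase]
        refine ⟨u, ⟨?_, Finset.mem_univ _⟩, by rw [h, Sym2.eq_swap]⟩
        rintro rfl
        exact hne (h.symm.trans hf.1)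
  have hcard := Set.ncard_le_ncard hsub (Finset.finite_toSet _)
  rw [Set.ncard_coe_finset] at hcard
  have h1 := hcard.trans Finset.card_image_le
  rw [Finset.card_erase_of_mem (Finset.mem_univ r), Finset.card_univ] at h1
  have hpos : 0 < Fintype.card V := Fintype.card_pos_iff.2 ⟨r⟩
  rw [Nat.card_coe_set_eq, Nat.card_eq_fintype_card]
  omega

lemma IsParentMap.ne_of_ne (hf : IsParentMap r f) {v : V} (hv : v ≠ r) : v ≠ f v := by
  intro h
  obtain ⟨k, hk⟩ := hf.2 v
  rw [Function.iterate_fixed h.symm] at hk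
  exact hv hk

lemma IsParentMap.apply_apply_ne (hf : IsParentMap r f) {v : V} (hv : v ≠ r) : f (f v) ≠ v := by
  intro h
  have hfv : f v ≠ r := fun h' => hv (by rw [← h, h', hf.1])
  have key : ∀ k, f^[k] v = v ∨ f^[k] v = f v := by
    intro k
    induction k with
    | zero => exact Or.inl rfl
    | succ k ih =>
      rw [Function.iterate_succ_apply']
      rcases ih with h' | h' <;> rw [h']
      · exact Or.inr rfl
      · exact Or.inl h
  obtain ⟨k, hk⟩ := hf.2 v
  rcases key k with h' | h'
  · exact hv (h'.symm.trans hk)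
  · exact hfv (h'.symm.trans hk)

/-- A disagreement at `v` propagates to `f v`: the edge from `v` to `f v` must come from `g (f v) =
v`, while `f (f v) ≠ v`. Iterating reaches `r`, where both maps agree. -/
lemma IsParentMap.ext_functionGraph (hf : IsParentMap r f) (hg : IsParentMap r g)
    (h : functionGraph f = functionGraph g) : f = g := by
  have step : ∀ v, f v ≠ g v → f (f v) ≠ g (f v) := by
    intro v hv
    have hvr : v ≠ r := by
      rintro rfl
      exact hv (hf.1.trans hg.1.symm)
    have hadj : (functionGraph g).Adj v (f v) :=
      h ▸ functionGraph_adj.2 ⟨hf.ne_of_ne hvr, Or.inl rfl⟩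
    rcases (functionGraph_adj.1 hadj).2 with h' | h'
    · exact absurd h'.symm hv
    · rw [h']
      exact hf.apply_apply_ne hvr
  funext v
  by_contra hv
  have key : ∀ k, f (f^[k] v) ≠ g (f^[k] v) := by
    intro k
    induction k with
    | zero => exact hv
    | succ k ih =>
      rw [Function.iterate_succ_apply']
      exact step _ ih
  obtain ⟨k, hk⟩ := hf.2 v
  exact key k (by rw [hk, hf.1, hg.1])

lemma SimpleGraph.Connected.exists_isParentMap {T : SimpleGraph V} (hT : T.Connected) (r : V) :
    ∃ f, IsParentMap r f ∧ ∀ v, v ≠ r → T.Adj v (f v) := by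
  have hex : ∀ v, ∃ u, (v = r → u = r) ∧ (v ≠ r → T.Adj v u ∧ T.dist u r < T.dist v r) := by
    intro v
    by_cases hv : v = r
    · exact ⟨r, fun _ => rfl, fun h => absurd hv h⟩
    -- The parent is the next vertex on a geodesic to `r`.
    · obtain ⟨w, hw⟩ := hT.exists_walk_length_eq_dist v r
      cases w with
      | nil => exact absurd rfl hv
      | cons hadj q =>
        refine ⟨_, fun h => absurd h hv, fun _ => ⟨hadj, ?_⟩⟩
        rw [← hw, SimpleGraph.Walk.length_cons]
        exact Nat.lt_succ_of_le (SimpleGraph.dist_le q)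
  choose f hroot hstep using hex
  refine ⟨f, ⟨hroot r rfl, fun v => ?_⟩, fun v hv => (hstep v hv).1⟩
  induction hd : T.dist v r using Nat.strong_induction_on generalizing v with
  | _ d ih =>
    by_cases hv : v = r
    · exact ⟨0, hv⟩
    · obtain ⟨k, hk⟩ := ih _ (hd ▸ (hstep v hv).2) (f v) rfl
      exact ⟨k + 1, hk⟩

lemma functionGraph_le {T : SimpleGraph V} (hr : f r = r) (h : ∀ v, v ≠ r → T.Adj v (f v)) :
    functionGraph f ≤ T := by
  have key : ∀ v u, v ≠ u → f v = u → T.Adj v u := by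
    rintro v _ hne rfl
    refine h v ?_
    rintro rfl
    exact hne hr.symm
  intro v u hvu
  obtain ⟨hne, h' | h'⟩ := functionGraph_adj.1 hvu
  · exact key v u hne h'
  · exact (key u v hne.symm h').symm

/-- Spanning trees correspond to parent maps. -/
theorem bijOn_functionGraph [Fintype V] (G : SimpleGraph V) (r : V) :
    Set.BijOn functionGraph {f | (∀ v, f v ∈ parentChoices G r v) ∧ IsParentMap r f}
      (labeledSpanningTrees G) := by
  refine ⟨fun f hf => ⟨functionGraph_le hf.2.1 fun v hv => ?_, hf.2.functionGraph_isTree⟩,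
    fun f hf g hg h => hf.2.ext_functionGraph hg.2 h, fun T hT => ?_⟩
  · have := hf.1 v
    rw [parentChoices, if_neg hv] at this
    simpa using this
  · obtain ⟨f, hf, hadj⟩ := hT.2.connected.exists_isParentMap r
    refine ⟨f, ⟨fun v => ?_, hf⟩, ?_⟩
    · unfold parentChoices
      split_ifs with hv
      · rw [hv, hf.1, Finset.mem_singleton]
      · simpa using hT.1 (hadj v hv)
    · have hle := functionGraph_le hf.1 hadj
      exact le_antisymm hle ((SimpleGraph.isTree_iff_minimal_connected.1 hT.2).2
        hf.functionGraph_connected hle)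

end Functional

/-! ### The matrix-tree theorem -/

section Determinant

variable {V : Type*} [Fintype V] [DecidableEq V] {r : V} {f : V → V}

/-- The matrix `1 - N`, where `N` is the transition matrix of `f` with the column of `r` erased. -/
def parentMatrix (r : V) (f : V → V) : Matrix V V ℚ :=
  Matrix.of fun v u => (if v = u then 1 else 0) - if f v = u ∧ u ≠ r then 1 else 0

/-- Ordering vertices by distance to `r` along `f` makes the matrix triangular with unit diagonal;
erasing the column of `r` removes the loop at `r`. -/
lemma IsParentMap.det_parentMatrix (hf : IsParentMap r f) : (parentMatrix r f).det = 1 := by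
  let depth : V → ℕ := fun v => Nat.find (hf.2 v)
  have hdepth : ∀ v, f v ≠ r → depth (f v) < depth v := by
    intro v hv
    have hvr : v ≠ r := by
      rintro rfl
      exact hv hf.1
    have hspec : f^[depth v] v = r := Nat.find_spec (hf.2 v)
    obtain ⟨k, hk⟩ : ∃ k, depth v = k + 1 := by
      refine Nat.exists_eq_succ_of_ne_zero fun h0 => hvr ?_
      rw [h0] at hspec
      exact hspec
    rw [hk] at hspec ⊢
    exact Nat.lt_succ_of_le (Nat.find_min' (hf.2 (f v)) hspec)
  have htri : (parentMatrix r f).BlockTriangular fun v => OrderDual.toDual (depth v) := by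
    intro v u hvu
    have hlt : depth v < depth u := hvu
    have h1 : v ≠ u := by
      rintro rfl
      exact lt_irrefl _ hlt
    have h2 : ¬ (f v = u ∧ u ≠ r) := by
      rintro ⟨rfl, hr⟩
      exact lt_asymm hlt (hdepth v hr)
    simp [parentMatrix, h1, h2]
  rw [htri.det]
  refine Finset.prod_eq_one fun a _ => ?_
  have : (parentMatrix r f).toSquareBlock (fun v => OrderDual.toDual (depth v)) a = 1 := by
    ext ⟨v, hv⟩ ⟨u, hu⟩
    have hvu : depth v = depth u := OrderDual.toDual.injective (hv.trans hu.symm)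
    have h2 : ¬ (f v = u ∧ u ≠ r) := by
      rintro ⟨rfl, hr⟩
      exact (hdepth v hr).ne' hvu
    simp [parentMatrix, Matrix.toSquareBlock_def, Matrix.one_apply, h2]
  rw [this, Matrix.det_one]

lemma det_parentMatrix_eq_zero (hr : f r = r) (hf : ¬ IsParentMap r f) :
    (parentMatrix r f).det = 0 := by
  classical
  obtain ⟨v₀, hv₀⟩ : ∃ v, ∀ k, f^[k] v ≠ r := by
    by_contra! h
    exact hf ⟨hr, h⟩
  -- A kernel vector: the indicator of the vertices that never reach `r`. It is `f`-invariant and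
  -- vanishes at `r`, so the erased column is harmless.
  let x : V → ℚ := fun v => if ∃ k, f^[k] v = r then 0 else 1
  have hxr : x r = 0 := if_pos ⟨0, rfl⟩
  have hxf : ∀ v, x (f v) = x v := by
    intro v
    have : (∃ k, f^[k] (f v) = r) ↔ ∃ k, f^[k] v = r := by
      constructor
      · rintro ⟨k, hk⟩
        exact ⟨k + 1, hk⟩
      · rintro ⟨k, hk⟩
        refine ⟨k, ?_⟩
        rw [← Function.iterate_succ_apply, Function.iterate_succ_apply', hk, hr]
    simp only [x, this]
  refine Matrix.exists_mulVec_eq_zero_iff.1 ⟨x, fun h0 => ?_, ?_⟩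
  · have := congrFun h0 v₀
    simp [x, hv₀] at this
  · ext v
    have hsum : ∀ u, parentMatrix r f v u * x u =
        (if v = u then x u else 0) - if f v = u then x u else 0 := by
      intro u
      by_cases hu : u = r
      · simp [hu, hxr]
      · simp [parentMatrix, hu, sub_mul]
    simp [Matrix.mulVec, dotProduct, hsum, Finset.sum_sub_distrib, hxf]

/-- The Laplacian of `G` in which the row and the column of `r` are replaced by those of the
identity matrix. -/
noncomputable def rootedLaplacian (G : SimpleGraph V) (r : V) : Matrix V V ℚ :=
  open Classical in Matrix.of fun v u =>
    (if v = u then ((parentChoices G r v).card : ℚ) else 0) -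
      if u ∈ parentChoices G r v ∧ u ≠ r then 1 else 0

lemma rootedLaplacian_row (G : SimpleGraph V) (r v : V) :
    rootedLaplacian G r v = ∑ w ∈ parentChoices G r v,
      fun u => ((if v = u then 1 else 0) - if w = u ∧ u ≠ r then 1 else 0 : ℚ) := by
  classical
  ext u
  rw [Finset.sum_apply, Finset.sum_sub_distrib, Finset.sum_const, nsmul_eq_mul]
  by_cases hu : u = r <;> simp [rootedLaplacian, hu]

/-- **Matrix-tree theorem**. -/
theorem det_rootedLaplacian (G : SimpleGraph V) (r : V) :
    (rootedLaplacian G r).det = (labeledSpanningTrees G).ncard := by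
  classical
  have hexp : (rootedLaplacian G r).det =
      ∑ f ∈ Fintype.piFinset (parentChoices G r), (parentMatrix r f).det := by
    have := (Matrix.detRowAlternating (n := V) (R := ℚ)).toMultilinearMap.map_sum_finset
      (fun v w u => ((if v = u then 1 else 0) - if w = u ∧ u ≠ r then 1 else 0 : ℚ))
      (parentChoices G r)
    simp only [← rootedLaplacian_row] at this
    exact this
  have hset : {f | (∀ v, f v ∈ parentChoices G r v) ∧ IsParentMap r f} =
      ((Fintype.piFinset (parentChoices G r)).filter (IsParentMap r) : Finset (V → V)) := by
    ext f
    simp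
  rw [← (bijOn_functionGraph G r).image_eq, (bijOn_functionGraph G r).injOn.ncard_image, hset,
    Set.ncard_coe_finset, hexp, Finset.card_filter, Nat.cast_sum]
  refine Finset.sum_congr rfl fun f hf => ?_
  have hr : f r = r := by
    have := Fintype.mem_piFinset.1 hf r
    simpa [parentChoices] using this
  split_ifs with h
  · simpa using h.det_parentMatrix
  · simpa using det_parentMatrix_eq_zero hr h

end Determinant

/-! ### Reduction to a determinant indexed by the parts -/

section Multipartite

variable {ι : Type*} [Fintype ι] [DecidableEq ι] {s : ι → ℕ}

lemma card_parentChoices_completeMultipartiteGraph (r v : Σ i, Fin (s i)) :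
    ((parentChoices (SimpleGraph.completeMultipartiteGraph fun i => Fin (s i)) r v).card : ℚ) =
      if v = r then 1 else ∑ j ∈ Finset.univ.erase v.1, (s j : ℚ) := by
  classical
  unfold parentChoices
  split_ifs with h
  · simp
  · trans (((Finset.univ.erase v.1).sigma fun i => (Finset.univ : Finset (Fin (s i)))).card : ℚ)
    · congr 2
      ext u
      simp [eq_comm]
    · rw [Finset.card_sigma]
      simp

/-- The number of vertices of the part `j` other than the root. -/
lemma sum_ite_part_ne (r : Σ i, Fin (s i)) (j : ι) (x : ℚ) :
    ∑ v : Σ i, Fin (s i), (if v.1 = j ∧ v ≠ r then x else 0) =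
      (s j - if r.1 = j then 1 else 0) * x := by
  have h : ∀ v : Σ i, Fin (s i), (if v.1 = j ∧ v ≠ r then x else 0) =
      (if v.1 = j then x else 0) - if v = r then (if r.1 = j then x else 0) else 0 := by
    intro v
    by_cases hv : v = r
    · simp [hv]
    · simp [hv]
  have h2 : ∑ v : Σ i, Fin (s i), (if v.1 = j then x else 0) = s j * x := by
    rw [Fintype.sum_sigma, Finset.sum_eq_single j]
    · simp
    · intro i _ hi
      simp [hi]
    · simp
  rw [Finset.sum_congr rfl fun v _ => h v, Finset.sum_sub_distrib, h2, Finset.sum_ite_eq',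
    if_pos (Finset.mem_univ r), sub_mul, ite_mul, one_mul, zero_mul]

/-- The number of spanning trees of a complete multipartite graph, as a determinant indexed by the
parts. -/
theorem ncard_labeledSpanningTrees_completeMultipartiteGraph (r : Σ i, Fin (s i)) (d : ι → ℚ)
    (hd : ∀ i, d i = ∑ j ∈ Finset.univ.erase i, (s j : ℚ)) (hd0 : ∀ i, d i ≠ 0) :
    ((labeledSpanningTrees
        (SimpleGraph.completeMultipartiteGraph fun i => Fin (s i))).ncard : ℚ) * d r.1 =
      (∏ i, d i ^ s i) * (1 - Matrix.of fun i j : ι =>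
        if i = j then (0 : ℚ) else (s j - if r.1 = j then 1 else 0) * (d j)⁻¹).det := by
  classical
  -- The root has entry 1 instead of its degree, whence the factor `d r.1` in the statement.
  let D : (Σ i, Fin (s i)) → ℚ := fun v => if v = r then 1 else d v.1
  let A : Matrix (Σ i, Fin (s i)) ι ℚ :=
    Matrix.of fun v j => if v.1 = j ∧ v ≠ r then (d j)⁻¹ else 0
  let B : Matrix ι (Σ i, Fin (s i)) ℚ :=
    Matrix.of fun i v => if i ≠ v.1 ∧ v ≠ r then 1 else 0
  have hfactor : rootedLaplacian (SimpleGraph.completeMultipartiteGraph fun i => Fin (s i)) r =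
      Matrix.diagonal D * (1 - A * B) := by
    ext v u
    have hAB : (A * B) v u = if v ≠ r ∧ v.1 ≠ u.1 ∧ u ≠ r then (d v.1)⁻¹ else 0 := by
      rw [Matrix.mul_apply, Finset.sum_eq_single v.1]
      · by_cases hv : v = r <;> simp [A, B, hv]
      · intro j _ hj
        simp [A, hj.symm]
      · simp
    rw [Matrix.diagonal_mul, Matrix.sub_apply, hAB, Matrix.one_apply, rootedLaplacian,
      Matrix.of_apply, card_parentChoices_completeMultipartiteGraph, ← hd]
    by_cases hv : v = r
    · by_cases hu : u = r
      · simp [D, hv, hu]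
      · simp [D, parentChoices, hv, hu, Ne.symm hu]
    · have hmem : u ∈ parentChoices
          (SimpleGraph.completeMultipartiteGraph fun i => Fin (s i)) r v ↔ v.1 ≠ u.1 := by
        simp [parentChoices, hv]
      by_cases hvu : v.1 ≠ u.1 ∧ u ≠ r
      · simp [D, hmem, hv, hvu, mul_sub, hd0]
      · simp [D, hmem, hv, hvu]
  have hBA : B * A = Matrix.of fun i j : ι =>
      if i = j then (0 : ℚ) else (s j - if r.1 = j then 1 else 0) * (d j)⁻¹ := by
    ext i j
    rw [Matrix.mul_apply, Matrix.of_apply]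
    by_cases h : i = j
    · rw [if_pos h]
      refine Finset.sum_eq_zero fun v _ => ?_
      by_cases hv : v.1 = j
      · simp [B, h, hv]
      · simp [A, hv]
    · rw [if_neg h, ← sum_ite_part_ne r j]
      refine Finset.sum_congr rfl fun v _ => ?_
      by_cases hv : v.1 = j ∧ v ≠ r
      · simp [A, B, hv, h]
      · simp [A, hv]
  have hprod : (∏ v, D v) * d r.1 = ∏ i, d i ^ s i := by
    have h1 : ∏ i, d i ^ s i = ∏ v : Σ i, Fin (s i), d v.1 := by
      rw [Fintype.prod_sigma]
      simp
    rw [h1, ← Finset.prod_erase_mul _ _ (Finset.mem_univ r),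
      ← Finset.prod_erase_mul _ (fun v : Σ i, Fin (s i) => d v.1) (Finset.mem_univ r)]
    have h2 : ∏ v ∈ Finset.univ.erase r, D v = ∏ v ∈ Finset.univ.erase r, d v.1 :=
      Finset.prod_congr rfl fun v hv => if_neg (Finset.ne_of_mem_erase hv)
    rw [h2]
    simp [D]
  rw [← det_rootedLaplacian _ r, hfactor, Matrix.det_mul, Matrix.det_diagonal,
    Matrix.det_one_sub_mul_comm, hBA, ← hprod]
  ring

end Multipartite

theorem theorem2p1 (m n p : ℕ) (hm : 1 ≤ m) (hn : 1 ≤ n) (hp : 1 ≤ p) :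
    (labeledSpanningTrees (completeTripartiteGraph m n p)).ncard =
      (m + n) ^ (p - 1) * (m + p) ^ (n - 1) * (n + p) ^ (m - 1) * (m + n + p) := by
  -- Shifting the sizes by one removes the truncated subtractions.
  obtain ⟨m, rfl⟩ := Nat.exists_eq_add_of_le' hm
  obtain ⟨n, rfl⟩ := Nat.exists_eq_add_of_le' hn
  obtain ⟨p, rfl⟩ := Nat.exists_eq_add_of_le' hp
  have hd1 : (n + 1 + (p + 1) : ℚ) ≠ 0 := by positivity
  have hd2 : (m + 1 + (p + 1) : ℚ) ≠ 0 := by positivity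
  have hd3 : (m + 1 + (n + 1) : ℚ) ≠ 0 := by positivity
  have h := ncard_labeledSpanningTrees_completeMultipartiteGraph
    (s := ![m + 1, n + 1, p + 1]) ⟨2, (0 : Fin (p + 1))⟩
    ![(n + 1 + (p + 1) : ℚ), m + 1 + (p + 1), m + 1 + (n + 1)]
    (by
      intro i
      have he : ∑ j ∈ Finset.univ.erase i, ((![m + 1, n + 1, p + 1] j : ℕ) : ℚ) =
          ∑ j, ((![m + 1, n + 1, p + 1] j : ℕ) : ℚ) - ((![m + 1, n + 1, p + 1] i : ℕ) : ℚ) :=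
        Finset.sum_erase_eq_sub (Finset.mem_univ i)
      rw [he, Fin.sum_univ_three]
      fin_cases i <;> simp <;> ring)
    (by
      intro i
      fin_cases i
      exacts [hd1, hd2, hd3])
  rw [Matrix.det_fin_three, Fin.prod_univ_three] at h
  simp at h
  have hq : ((labeledSpanningTrees (completeTripartiteGraph (m + 1) (n + 1) (p + 1))).ncard : ℚ) =
      ((m + 1) + (n + 1)) ^ p * ((m + 1) + (p + 1)) ^ n * ((n + 1) + (p + 1)) ^ m *
        ((m + 1) + (n + 1) + (p + 1)) := by
    -- The root lies in the third part, so the factor to cancel is the degree there.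
    refine mul_right_cancel₀ hd3 (h.trans ?_)
    field_simp
    ring
  simp only [Nat.add_sub_cancel]
  exact_mod_cast hq
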